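/- Let $P_X$ be a probability mass function on a finite alphabet $\mathcal{X}$, and for $n\ge 1$ let $X^n=(X_1,\dots,X_n)$ consist of i.i.d. random variables with distribution $P_X$. All logarithms are natural. Put $\imath(x|P_X)=-\log P_X(x)$, let $H(P_X)=-\sum_{x\in\mathcal{X}}P_X(x)\log P_X(x)$ be the entropy (with $0\log 0=0$), let $\mathrm{V}(P_X)=\mathrm{Var}[-\log P_X(X_1)]$ be the dispersion (varentropy), let $\mathrm{Q}(t)=\int_t^\infty \frac{1}{\sqrt{2\pi}}e^{-u^2/2}\,du$ for $t\in\mathbb{R}$, and let $\mathrm{Q}^{-1}:(0,1)\to\mathbb{R}$ be its inverse. For positive integers $n,M$, an $(n,M)$-code consists of an encoder $f:\mathcal{X}^n\to\{1,\dots,M\}$ and a decoder $\phi:\{1,\dots,M\}\to\mathcal{X}^n$; its error probability is $\mathrm{P}_{\mathrm{e},n}=\Pr\{\phi(f(X^n))\ne X^n\}$. Let $M^*(n,\varepsilon)$ be the smallest $M$ for which there is an $(n,M)$-code with $\mathrm{P}_{\mathrm{e},n}\le\varepsilon$. Then the following hold. (i) For all positive integers $n,M$ there is an $(n,M)$-code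 with $$\mathrm{P}_{\mathrm{e},n}\le \Pr\Big\{\sum_{i=1}^n\imath(X_i|P_X)\ge\log M\Big\}.$$ (ii) For all positive integers $n,M$ and every real $\gamma\ge 0$, every $(n,M)$-code satisfies $$\mathrm{P}_{\mathrm{e},n}\ge \Pr\Big\{\sum_{i=1}^n\imath(X_i|P_X)\ge\log M+n\gamma\Big\}-e^{-n\gamma}.$$ (iii) For every $\varepsilon\in(0,1)$, as $n\to\infty$, $$\log M^*(n,\varepsilon)=nH(P_X)+\sqrt{n\mathrm{V}(P_X)}\,\mathrm{Q}^{-1}(\varepsilon)+O(\log n),$$ where the implied constant may depend on $P_X$ and $\varepsilon$. -/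

import Mathlib

open MeasureTheory

noncomputable section

namespace LosslessSource

section Source

variable {𝒳 : Type*} [Fintype 𝒳] [MeasurableSpace 𝒳]

/-- The entropy density `ι(x|P) = -log P(x)`, in nats. On symbols of probability zero (where the
mathematical value is `+∞`) it takes the value `0`; such symbols occur with probability zero, so
this affects neither its moments under `P` nor the probability of any event. -/
def entropyDensity (P : PMF 𝒳) (x : 𝒳) : ℝ := -Real.log (P x).toReal

/-- The Shannon entropy `H(P) = -∑ₓ P(x) log P(x)`, in nats, with `0 log 0 = 0`. -/
def entropy (P : PMF 𝒳) : ℝ := -∑ x, (P x).toReal * Real.log (P x).toReal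

/-- The dispersion (varentropy) `V(P) = Var[-log P(X)]` with `X ∼ P`. -/
def dispersion (P : PMF 𝒳) : ℝ :=
  ProbabilityTheory.variance (entropyDensity P) P.toMeasure

/-- The law of `Xⁿ = (X₁, …, Xₙ)` with `X₁, …, Xₙ` i.i.d. with distribution `P`. -/
def sourceLaw (P : PMF 𝒳) (n : ℕ) : Measure (Fin n → 𝒳) :=
  Measure.pi fun _ => P.toMeasure

end Source

/-- An `(n, M)`-code with alphabet `𝒳`; the message set `{1, …, M}` is represented by `Fin M`. -/
structure Code (𝒳 : Type*) (n M : ℕ) where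
  /-- The encoder. -/
  enc : (Fin n → 𝒳) → Fin M
  /-- The decoder. -/
  dec : Fin M → (Fin n → 𝒳)

/-- The error probability `Pr{φ(f(Xⁿ)) ≠ Xⁿ}` of a code. -/
def Code.errorProb {𝒳 : Type*} [Fintype 𝒳] [MeasurableSpace 𝒳] {n M : ℕ}
    (c : Code 𝒳 n M) (P : PMF 𝒳) : ℝ :=
  (sourceLaw P n).real {x | c.dec (c.enc x) ≠ x}

/-- `M*(n, ε)`, the smallest `M` such that some `(n, M)`-code has error probability at
most `ε`. -/
def minCodewords {𝒳 : Type*} [Fintype 𝒳] [MeasurableSpace 𝒳] (P : PMF 𝒳) (n : ℕ) (ε : ℝ) : ℕ :=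
  sInf {M : ℕ | ∃ c : Code 𝒳 n M, c.errorProb P ≤ ε}

/-- The set in the definition of `minCodewords` is non-empty, so that its infimum is attained. -/
theorem exists_code_errorProb_le {𝒳 : Type*} [Fintype 𝒳] [MeasurableSpace 𝒳] (P : PMF 𝒳)
    (n : ℕ) {ε : ℝ} (hε : 0 ≤ ε) :
    {M : ℕ | ∃ c : Code 𝒳 n M, c.errorProb P ≤ ε}.Nonempty := by
  classical
  let e := Fintype.equivFin (Fin n → 𝒳)
  exact ⟨Fintype.card (Fin n → 𝒳), ⟨e, e.symm⟩, by simp [Code.errorProb, hε]⟩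

/-- The complementary distribution function of the standard Gaussian. -/
def gaussianQ (t : ℝ) : ℝ :=
  ∫ u in Set.Ioi t, 1 / Real.sqrt (2 * Real.pi) * Real.exp (-u ^ 2 / 2)

/-- The inverse function of `gaussianQ`. -/
def gaussianQInv : ℝ → ℝ := Function.invFun gaussianQ

theorem gaussianQ_eq (t : ℝ) :
    gaussianQ t = (ProbabilityTheory.gaussianReal 0 1).real (Set.Ioi t) := by
  rw [measureReal_def, ProbabilityTheory.gaussianReal_apply_eq_integral 0 one_ne_zero,
    ENNReal.toReal_ofReal]
  · simp [gaussianQ, ProbabilityTheory.gaussianPDFReal]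
  · exact setIntegral_nonneg measurableSet_Ioi
      fun x _ => ProbabilityTheory.gaussianPDFReal_nonneg 0 1 x

theorem gaussianQ_eq_one_sub (t : ℝ) :
    gaussianQ t = 1 - ProbabilityTheory.cdf (ProbabilityTheory.gaussianReal 0 1) t := by
  rw [gaussianQ_eq, ProbabilityTheory.cdf_eq_real, ← Set.compl_Iic,
    probReal_compl_eq_one_sub measurableSet_Iic]

theorem integrable_gaussianQ_density :
    Integrable fun u : ℝ => 1 / Real.sqrt (2 * Real.pi) * Real.exp (-u ^ 2 / 2) := by
  have h := ProbabilityTheory.integrable_gaussianPDFReal 0 1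
  refine h.congr (Filter.Eventually.of_forall fun u => ?_)
  simp [ProbabilityTheory.gaussianPDFReal]

theorem gaussianQ_sub (a b : ℝ) : gaussianQ a - gaussianQ b =
    ∫ u in a..b, 1 / Real.sqrt (2 * Real.pi) * Real.exp (-u ^ 2 / 2) := by
  rw [gaussianQ, gaussianQ]
  exact intervalIntegral.integral_Ioi_sub_Ioi' integrable_gaussianQ_density.integrableOn
    integrable_gaussianQ_density.integrableOn

theorem strictAnti_gaussianQ : StrictAnti gaussianQ := by
  intro a b hab
  have h : 0 < gaussianQ a - gaussianQ b := by
    rw [gaussianQ_sub]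
    exact intervalIntegral.intervalIntegral_pos_of_pos
      integrable_gaussianQ_density.intervalIntegrable (fun u => by positivity) hab
  linarith

theorem continuous_gaussianQ : Continuous gaussianQ := by
  have h : gaussianQ = fun t => gaussianQ 0 -
      ∫ u in (0 : ℝ)..t, 1 / Real.sqrt (2 * Real.pi) * Real.exp (-u ^ 2 / 2) := by
    funext t
    rw [← gaussianQ_sub]
    ring
  rw [h]
  exact continuous_const.sub (intervalIntegral.continuous_primitive
    (fun a b => integrable_gaussianQ_density.intervalIntegrable) 0)

/-- `gaussianQInv` is a genuine right inverse of `gaussianQ` on `(0, 1)`. -/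
theorem gaussianQ_gaussianQInv {ε : ℝ} (hε : ε ∈ Set.Ioo (0 : ℝ) 1) :
    gaussianQ (gaussianQInv ε) = ε := by
  refine Function.invFun_eq ?_
  have h1 : Filter.Tendsto gaussianQ Filter.atTop (nhds 0) := by
    have := (ProbabilityTheory.tendsto_cdf_atTop
      (ProbabilityTheory.gaussianReal 0 1)).const_sub 1
    simpa [funext gaussianQ_eq_one_sub] using this
  have h2 : Filter.Tendsto gaussianQ Filter.atBot (nhds 1) := by
    have := (ProbabilityTheory.tendsto_cdf_atBot
      (ProbabilityTheory.gaussianReal 0 1)).const_sub 1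
    simpa [funext gaussianQ_eq_one_sub] using this
  obtain ⟨a, ha⟩ := (h1.eventually (gt_mem_nhds hε.1)).exists
  obtain ⟨b, hb⟩ := (h2.eventually (lt_mem_nhds hε.2)).exists
  exact mem_range_of_exists_le_of_exists_ge continuous_gaussianQ ⟨a, ha.le⟩ ⟨b, hb.le⟩

/-- `gaussianQInv` is a genuine left inverse of `gaussianQ`. -/
theorem gaussianQInv_gaussianQ (t : ℝ) : gaussianQInv (gaussianQ t) = t :=
  Function.leftInverse_invFun strictAnti_gaussianQ.injective t

end LosslessSource

end

open MeasureTheory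

noncomputable section

namespace LosslessSource

/-! ### Non-asymptotic achievability and converse bounds by counting. -/

section

/-! At most `M` sequences have probability at least `1/M`; a code that recovers exactly these errs
only where the information content exceeds `log M`. Conversely, the correctly decoded sequences
inject into the messages, so there are at most `M` of them, and those with information content at
least `log M + δ` have total probability at most `exp (-δ)`. These are
`exists_code_errorProb_le_tail` and `tail_sub_exp_le_errorProb`.

Taking `δ = log n` pins `log M*` to the upper `ε`-quantile of an i.i.d. sum, up to `O(log n)` and a
slack `1/n` in probability. It remains to locate this quantile by a quantitative central limit
theorem.

Since a shift of order `log n` is harmless, full Berry–Esseen is not needed. Both the sum and its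
Gaussian counterpart are smoothed by an independent Gaussian of variance `v` proportional to `log
n`. The damping `exp (-v s²/2)` makes frequencies away from zero contribute `O(1/n)`; near zero a
third-order Taylor comparison gives `O(1/√n)`; and the smoothing displaces tails by only `O(log n)`
(`exists_gaussian_approx`). The Gaussian tail has slope bounded away from zero near its quantile, so
an `O(1/√n)` error in probability also costs only a bounded shift of the unnormalised sum. Zero
dispersion is separate: the sum is then deterministic. -/

theorem entropyDensity_nonneg {𝒳 : Type*} (P : PMF 𝒳) (x : 𝒳) : 0 ≤ entropyDensity P x := by
  have h : (P x).toReal ≤ 1 :=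
    ENNReal.toReal_le_of_le_ofReal zero_le_one (by simpa using P.coe_le_one x)
  have := Real.log_nonpos ENNReal.toReal_nonneg h
  simp only [entropyDensity]; linarith

variable {𝒳 : Type*} [Fintype 𝒳] [MeasurableSpace 𝒳]

instance (P : PMF 𝒳) (n : ℕ) : IsProbabilityMeasure (sourceLaw P n) := by
  unfold sourceLaw; infer_instance

theorem exists_code_of_card_le {n M : ℕ} [Nonempty 𝒳] (P : PMF 𝒳) (hM : 0 < M)
    (s : Finset (Fin n → 𝒳)) (hs : s.card ≤ M) :
    ∃ c : Code 𝒳 n M, c.errorProb P ≤ (sourceLaw P n).real (s : Set (Fin n → 𝒳))ᶜ := by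
  classical
  have : NeZero M := ⟨hM.ne'⟩
  have hcard : Fintype.card s ≤ Fintype.card (Fin M) := by simpa using hs
  obtain ⟨e⟩ := Function.Embedding.nonempty_of_card_le hcard
  let f : (Fin n → 𝒳) → Fin M := fun x => if h : x ∈ s then e ⟨x, h⟩ else 0
  have hf : Set.InjOn f s := by
    intro x hx y hy hxy
    rw [Finset.mem_coe] at hx hy
    simpa [f, hx, hy] using hxy
  refine ⟨⟨f, Function.invFunOn f s⟩, measureReal_mono fun x hx hxs => ?_⟩
  exact hx (hf.leftInvOn_invFunOn hxs)

theorem minCodewords_spec (P : PMF 𝒳) (n : ℕ) {ε : ℝ} (hε : 0 ≤ ε) :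
    ∃ c : Code 𝒳 n (minCodewords P n ε), c.errorProb P ≤ ε :=
  Nat.sInf_mem (exists_code_errorProb_le P n hε)

theorem minCodewords_pos (P : PMF 𝒳) (n : ℕ) {ε : ℝ} (hε : 0 ≤ ε) : 0 < minCodewords P n ε := by
  obtain ⟨c, -⟩ := minCodewords_spec P n hε
  obtain ⟨x, -⟩ := P.support_nonempty
  exact Nat.pos_of_ne_zero fun h => (Fin.cast h (c.enc fun _ => x)).elim0

variable [DiscreteMeasurableSpace 𝒳]

theorem sourceLaw_real_singleton (P : PMF 𝒳) {n : ℕ} (x : Fin n → 𝒳) :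
    (sourceLaw P n).real {x} = ∏ i, (P (x i)).toReal := by
  rw [measureReal_def, sourceLaw, Measure.pi_singleton, ENNReal.toReal_prod]
  simp_rw [P.toMeasure_apply_singleton _ (MeasurableSet.singleton _)]

/-- On the support of the source, the probability of a sequence is the exponential of minus its
information content. -/
theorem sourceLaw_real_singleton_eq_exp (P : PMF 𝒳) {n : ℕ} (x : Fin n → 𝒳)
    (hx : (sourceLaw P n).real {x} ≠ 0) :
    (sourceLaw P n).real {x} = Real.exp (-∑ i, entropyDensity P (x i)) := by
  rw [sourceLaw_real_singleton] at hx ⊢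
  have h : ∀ i, (P (x i)).toReal ≠ 0 := fun i => (Finset.prod_ne_zero_iff.mp hx) i (Finset.mem_univ i)
  rw [← Finset.sum_neg_distrib, Real.exp_sum]
  refine Finset.prod_congr rfl fun i _ => ?_
  rw [entropyDensity, neg_neg, Real.exp_log (lt_of_le_of_ne ENNReal.toReal_nonneg (h i).symm)]

theorem sourceLaw_real_le_sum (P : PMF 𝒳) {n : ℕ} (s : Finset (Fin n → 𝒳)) :
    (sourceLaw P n).real s = ∑ x ∈ s, (sourceLaw P n).real {x} := by
  simp

theorem exists_code_errorProb_le_tail (P : PMF 𝒳) (n M : ℕ) (hM : 0 < M) :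
    ∃ c : Code 𝒳 n M, c.errorProb P ≤ (sourceLaw P n).real
      {x | Real.log (M : ℝ) ≤ ∑ i, entropyDensity P (x i)} := by
  classical
  have : Nonempty 𝒳 := P.support_nonempty.to_type
  have hM' : (0 : ℝ) < M := by exact_mod_cast hM
  let s : Finset (Fin n → 𝒳) := Finset.univ.filter fun x => 1 / (M : ℝ) ≤ (sourceLaw P n).real {x}
  have hs : s.card ≤ M := by
    have h1 : (s.card : ℝ) * (1 / M) ≤ 1 := by
      calc (s.card : ℝ) * (1 / M) = ∑ x ∈ s, 1 / (M : ℝ) := by simp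
        _ ≤ ∑ x ∈ s, (sourceLaw P n).real {x} :=
          Finset.sum_le_sum fun x hx => (Finset.mem_filter.mp hx).2
        _ = (sourceLaw P n).real s := (sourceLaw_real_le_sum P s).symm
        _ ≤ 1 := measureReal_le_one
    rw [mul_one_div, div_le_one hM'] at h1
    exact_mod_cast h1
  obtain ⟨c, hc⟩ := exists_code_of_card_le P hM s hs
  refine ⟨c, hc.trans ?_⟩
  -- Null sequences may contain symbols where `entropyDensity` takes its default value 0, so they
  -- can miss the tail event; they are discarded as a null set.
  let z : Finset (Fin n → 𝒳) := Finset.univ.filter fun x => (sourceLaw P n).real {x} = 0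
  have hz : (sourceLaw P n).real z = 0 := by
    rw [sourceLaw_real_le_sum]
    exact Finset.sum_eq_zero fun x hx => (Finset.mem_filter.mp hx).2
  have hsub : (s : Set (Fin n → 𝒳))ᶜ ⊆
      {x | Real.log (M : ℝ) ≤ ∑ i, entropyDensity P (x i)} ∪ z := by
    intro x hx
    by_cases h0 : (sourceLaw P n).real {x} = 0
    · exact Or.inr (by simp [z, h0])
    · left
      have hlt : (sourceLaw P n).real {x} < 1 / M := by simpa [s] using hx
      rw [sourceLaw_real_singleton_eq_exp P x h0, one_div, ← Real.exp_log hM', ← Real.exp_neg,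
        Real.exp_lt_exp] at hlt
      change Real.log (M : ℝ) ≤ _; linarith
  calc _ ≤ _ := measureReal_mono hsub
    _ ≤ _ := measureReal_union_le _ _
    _ = _ := by rw [hz, add_zero]

theorem tail_sub_exp_le_errorProb (P : PMF 𝒳) (n M : ℕ) (hM : 0 < M) (δ : ℝ) (c : Code 𝒳 n M) :
    (sourceLaw P n).real {x | Real.log (M : ℝ) + δ ≤ ∑ i, entropyDensity P (x i)} - Real.exp (-δ)
      ≤ c.errorProb P := by
  classical
  have hM' : (0 : ℝ) < M := by exact_mod_cast hM
  let s : Finset (Fin n → 𝒳) := Finset.univ.filter fun x =>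
    c.dec (c.enc x) = x ∧ Real.log (M : ℝ) + δ ≤ ∑ i, entropyDensity P (x i)
  have hcard : s.card ≤ M := by
    have := Finset.card_le_card_of_injOn (s := s) (t := Finset.univ) c.enc (by simp) (by
      intro x hx y hy hxy
      have h1 := (Finset.mem_filter.mp hx).2.1
      have h2 := (Finset.mem_filter.mp hy).2.1
      rw [← h1, ← h2, hxy])
    simpa using this
  have hs : (sourceLaw P n).real s ≤ Real.exp (-δ) := by
    rw [sourceLaw_real_le_sum]
    calc ∑ x ∈ s, (sourceLaw P n).real {x} ≤ ∑ x ∈ s, Real.exp (-(Real.log M + δ)) := by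
          refine Finset.sum_le_sum fun x hx => ?_
          -- The exponential formula fails for null sequences, but there the bound is trivial.
          by_cases h0 : (sourceLaw P n).real {x} = 0
          · rw [h0]; positivity
          · rw [sourceLaw_real_singleton_eq_exp P x h0, Real.exp_le_exp]
            linarith [(Finset.mem_filter.mp hx).2.2]
      _ = s.card * (Real.exp (-δ) / M) := by
          rw [Finset.sum_const, nsmul_eq_mul, neg_add, Real.exp_add, Real.exp_neg, Real.exp_log hM']
          ring
      _ ≤ M * (Real.exp (-δ) / M) := by gcongr
      _ = Real.exp (-δ) := by field_simp
  have hsub : {x | Real.log (M : ℝ) + δ ≤ ∑ i, entropyDensity P (x i)} ⊆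
      {x | c.dec (c.enc x) ≠ x} ∪ s := by
    intro x hx
    by_cases h : c.dec (c.enc x) = x
    · exact Or.inr (by simpa [s, h] using hx)
    · exact Or.inl h
  have h1 := (measureReal_mono (μ := sourceLaw P n) hsub).trans (measureReal_union_le _ _)
  have h2 : c.errorProb P = (sourceLaw P n).real {x | c.dec (c.enc x) ≠ x} := rfl
  linarith

end

/-! ### Fourier inversion and Gaussian smoothing. -/

section

open ProbabilityTheory Complex NNReal

theorem integrable_cexp_neg_mul_sq_half (v : ℝ≥0) (hv : v ≠ 0) :
    Integrable fun s : ℝ => cexp (-(v / 2 : ℝ) * s ^ 2) := by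
  refine integrable_cexp_neg_mul_sq ?_
  have : (0 : ℝ) < v := by positivity
  simpa using this

/-- The Gaussian is its own Fourier transform up to scaling. The mean `x` is isolated in the factor
`exp (i x s)`, so that integrating over `x` against a measure produces its characteristic function.
-/
theorem gaussianPDFReal_eq_fourier (v : ℝ≥0) (hv : v ≠ 0) (x y : ℝ) :
    (gaussianPDFReal x v y : ℂ) =
      (1 / (2 * Real.pi) : ℝ) * ∫ s : ℝ, cexp (x * s * I) * (cexp (-(v / 2 : ℝ) * s ^ 2) *
        cexp (-(y * s * I))) := by
  have hv' : (0 : ℝ) < v := by positivity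
  have h := fourierIntegral_gaussian (b := ((v / 2 : ℝ) : ℂ)) (by simpa using hv') ((x - y : ℝ) : ℂ)
  have h2 : ∫ s : ℝ, cexp (x * s * I) * (cexp (-(v / 2 : ℝ) * s ^ 2) * cexp (-(y * s * I))) =
      ∫ s : ℝ, cexp (I * ((x - y : ℝ) : ℂ) * s) * cexp (-((v / 2 : ℝ) : ℂ) * s ^ 2) := by
    congr 1; ext s
    rw [← Complex.exp_add, ← Complex.exp_add, ← Complex.exp_add]
    congr 1; push_cast; ring
  rw [h2, h, gaussianPDFReal]
  have h3 : ((Real.pi : ℂ) / ((v / 2 : ℝ) : ℂ)) ^ (1 / 2 : ℂ) = ((√(Real.pi / (v / 2)) : ℝ) : ℂ) := by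
    rw [Real.sqrt_eq_rpow, Complex.ofReal_cpow (by positivity)]
    push_cast; rfl
  have h4 : cexp (-((x - y : ℝ) : ℂ) ^ 2 / (4 * ((v / 2 : ℝ) : ℂ))) =
      ((Real.exp (-(y - x) ^ 2 / (2 * v)) : ℝ) : ℂ) := by
    rw [Complex.ofReal_exp]; congr 1; push_cast; ring
  rw [h3, h4, ← Complex.ofReal_mul, ← Complex.ofReal_mul, ← mul_assoc]
  congr 2
  have h5 : √(Real.pi / (v / 2)) = 2 * Real.pi * (√(2 * Real.pi * v))⁻¹ := by
    rw [← div_eq_mul_inv, eq_div_iff (by positivity), ← Real.sqrt_mul (by positivity)]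
    rw [show Real.pi / (v / 2) * (2 * Real.pi * v) = (2 * Real.pi) ^ 2 by field_simp]
    exact Real.sqrt_sq (by positivity)
  rw [h5]; field_simp

theorem gaussianReal_Ioc_eq_fourier (v : ℝ≥0) (hv : v ≠ 0) (x a b : ℝ) :
    ((gaussianReal x v).real (Set.Ioc a b) : ℂ) =
      (1 / (2 * Real.pi) : ℝ) * ∫ s : ℝ, cexp (x * s * I) * (cexp (-(v / 2 : ℝ) * s ^ 2) *
        ∫ y in Set.Ioc a b, cexp (-(y * s * I))) := by
  have h1 : (gaussianReal x v).real (Set.Ioc a b) = ∫ y in Set.Ioc a b, gaussianPDFReal x v y := by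
    rw [measureReal_def, gaussianReal_apply_eq_integral x hv, ENNReal.toReal_ofReal]
    exact setIntegral_nonneg measurableSet_Ioc fun y _ => gaussianPDFReal_nonneg x v y
  rw [h1, ← integral_complex_ofReal]
  simp_rw [gaussianPDFReal_eq_fourier v hv, integral_const_mul]
  congr 1
  rw [integral_integral_swap]
  · simp_rw [integral_const_mul]
  · have hg : Integrable (fun p : ℝ × ℝ => (1 : ℂ) * cexp (-(v / 2 : ℝ) * p.2 ^ 2))
        ((volume.restrict (Set.Ioc a b)).prod volume) :=
      Integrable.mul_prod (integrable_const (1 : ℂ)) (integrable_cexp_neg_mul_sq_half v hv)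
    refine hg.norm.mono' (Continuous.aestronglyMeasurable (by fun_prop)) (.of_forall fun p => ?_)
    simp only [Function.uncurry, norm_mul, one_mul]
    rw [show (x * p.2 * I : ℂ) = (x * p.2 : ℝ) * I by push_cast; ring,
      show (-(p.1 * p.2 * I) : ℂ) = (-(p.1 * p.2) : ℝ) * I by push_cast; ring,
      norm_exp_ofReal_mul_I, norm_exp_ofReal_mul_I]
    simp

theorem norm_integral_cexp_le (a b s : ℝ) :
    ‖∫ y in Set.Ioc a b, cexp (-(y * s * I))‖ ≤ |b - a| := by
  have h := norm_setIntegral_le_of_norm_le_const (μ := volume) (s := Set.Ioc a b)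
    (f := fun y : ℝ => cexp (-(y * s * I))) (C := 1) (by simp) (fun y _ => by
      rw [show (-(y * s * I) : ℂ) = (-(y * s) : ℝ) * I by push_cast; ring, norm_exp_ofReal_mul_I])
  refine h.trans ?_
  simp [measureReal_def, ENNReal.toReal_ofReal', le_abs_self]

/-- Integrating the exponential explicitly gains a factor `1/|s|` with a constant that does not
involve the interval; this uniformity later allows its right end to go to infinity. -/
theorem norm_mul_integral_cexp_le (a b s : ℝ) :
    |s| * ‖∫ y in Set.Ioc a b, cexp (-(y * s * I))‖ ≤ 2 := by
  rcases lt_or_ge b a with hab | hab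
  · simp [Set.Ioc_eq_empty (not_lt.mpr hab.le)]
  rcases eq_or_ne s 0 with rfl | hs
  · simp
  rw [← intervalIntegral.integral_of_le hab]
  have h : ∀ y : ℝ, cexp (-(y * s * I)) = cexp ((-(s * I)) * y) := fun y => by congr 1; ring
  have hs' : (-(s * I) : ℂ) ≠ 0 := by simp [hs]
  simp_rw [h]
  rw [integral_exp_mul_complex hs', norm_div]
  have h1 : ∀ y : ℝ, ‖cexp ((-(s * I)) * y)‖ = 1 := fun y => by
    rw [show (-(s * I) * y : ℂ) = (-(s * y) : ℝ) * I by push_cast; ring, norm_exp_ofReal_mul_I]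
  have h2 := norm_sub_le (cexp ((-(s * I)) * b)) (cexp ((-(s * I)) * a))
  rw [h1, h1] at h2
  have h3 : ‖(-(s * I) : ℂ)‖ = |s| := by simp
  rw [h3, mul_div_cancel₀ _ (abs_ne_zero.mpr hs)]
  linarith

/-- The transform of an interval need not be integrable; the Gaussian factor supplied by the
smoothing makes it so, which justifies Fubini below. -/
theorem integrable_gaussian_mul_integral_cexp (v : ℝ≥0) (hv : v ≠ 0) (a b : ℝ) :
    Integrable fun s : ℝ => cexp (-(v / 2 : ℝ) * s ^ 2) *
        ∫ y in Set.Ioc a b, cexp (-(y * s * I)) := by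
  refine (integrable_cexp_neg_mul_sq_half v hv).mul_bdd (c := |b - a|) ?_
    (.of_forall fun s => norm_integral_cexp_le a b s)
  refine AEStronglyMeasurable.integral_prod_right' (μ := volume) (ν := volume.restrict (Set.Ioc a b))
    (f := fun p : ℝ × ℝ => cexp (-(p.2 * p.1 * I))) ?_
  exact Continuous.aestronglyMeasurable (by fun_prop)

/-- Fourier inversion for the probability that an independent sum `X + N`, with `X ∼ μ` and `N` a
centred Gaussian, falls in an interval. -/
theorem integral_gaussianReal_Ioc (μ : Measure ℝ) [IsProbabilityMeasure μ] (v : ℝ≥0) (hv : v ≠ 0)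
    (a b : ℝ) :
    ((∫ x, (gaussianReal x v).real (Set.Ioc a b) ∂μ : ℝ) : ℂ) =
      (1 / (2 * Real.pi) : ℝ) * ∫ s : ℝ, charFun μ s * (cexp (-(v / 2 : ℝ) * s ^ 2) *
        ∫ y in Set.Ioc a b, cexp (-(y * s * I))) := by
  rw [← integral_complex_ofReal]
  simp_rw [gaussianReal_Ioc_eq_fourier v hv, integral_const_mul]
  congr 1
  rw [integral_integral_swap]
  · simp_rw [integral_mul_const, charFun_apply_real]
    congr 1; ext s; congr 3; ext x; congr 1; ring
  · have hg : Integrable (fun p : ℝ × ℝ => (1 : ℂ) * (cexp (-(v / 2 : ℝ) * p.2 ^ 2) *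
        ∫ y in Set.Ioc a b, cexp (-(y * p.2 * I)))) (μ.prod volume) :=
      Integrable.mul_prod (integrable_const (1 : ℂ)) (integrable_gaussian_mul_integral_cexp v hv a b)
    refine (hg.bdd_mul (c := 1) (f := fun p : ℝ × ℝ => cexp (p.1 * p.2 * I))
      (Continuous.aestronglyMeasurable (by fun_prop)) (.of_forall fun p => ?_)).congr
      (.of_forall fun p => ?_)
    · rw [show (p.1 * p.2 * I : ℂ) = (p.1 * p.2 : ℝ) * I by push_cast; ring, norm_exp_ofReal_mul_I]
    · simp [Function.uncurry]

/-- The factor `|s|` in the hypothesis absorbs the `1/|s|` singularity of the interval's transform,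
so the bound is uniform in `a` and `b`. -/
theorem abs_integral_gaussianReal_Ioc_sub_le (μ ν : Measure ℝ) [IsProbabilityMeasure μ]
    [IsProbabilityMeasure ν] (v : ℝ≥0) (hv : v ≠ 0) (a b : ℝ) {g : ℝ → ℝ} (hg : Integrable g)
    (h : ∀ s, ‖charFun μ s - charFun ν s‖ * Real.exp (-(v / 2) * s ^ 2) ≤ |s| * g s) :
    |∫ x, (gaussianReal x v).real (Set.Ioc a b) ∂μ - ∫ x, (gaussianReal x v).real (Set.Ioc a b) ∂ν|
      ≤ 1 / Real.pi * ∫ s, g s := by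
  have hint : ∀ (ρ : Measure ℝ) [IsProbabilityMeasure ρ], Integrable fun s : ℝ =>
      charFun ρ s * (cexp (-(v / 2 : ℝ) * s ^ 2) * ∫ y in Set.Ioc a b, cexp (-(y * s * I))) :=
    fun ρ _ => (integrable_gaussian_mul_integral_cexp v hv a b).bdd_mul (c := 1)
      measurable_charFun.aestronglyMeasurable (.of_forall fun s => norm_charFun_le_one s)
  rw [← Real.norm_eq_abs, ← Complex.norm_real, Complex.ofReal_sub, integral_gaussianReal_Ioc μ v hv,
    integral_gaussianReal_Ioc ν v hv, ← mul_sub, ← integral_sub (hint μ) (hint ν), norm_mul,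
    Complex.norm_real, Real.norm_eq_abs, abs_of_pos (by positivity)]
  have key : ‖∫ s : ℝ, (charFun μ s * (cexp (-(v / 2 : ℝ) * s ^ 2) *
      ∫ y in Set.Ioc a b, cexp (-(y * s * I))) - charFun ν s * (cexp (-(v / 2 : ℝ) * s ^ 2) *
      ∫ y in Set.Ioc a b, cexp (-(y * s * I))))‖ ≤ ∫ s, 2 * g s := by
    refine norm_integral_le_of_norm_le (hg.const_mul 2) ?_
    have h0 : ∀ᵐ s : ℝ, s ≠ 0 := by simp [ae_iff]
    filter_upwards [h0] with s hs
    rw [← sub_mul, norm_mul, norm_mul, ← mul_assoc,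
      show (-(v / 2 : ℝ) * s ^ 2 : ℂ) = ((-(v / 2) * s ^ 2 : ℝ) : ℂ) by push_cast; ring,
      ← Complex.ofReal_exp, Complex.norm_real, Real.norm_eq_abs, abs_of_pos (Real.exp_pos _)]
    have hs' := abs_pos.mpr hs
    have hg0 : 0 ≤ g s := by
      have : 0 ≤ |s| * g s := le_trans (by positivity) (h s)
      exact nonneg_of_mul_nonneg_right this hs'
    calc _ ≤ |s| * g s * ‖∫ y in Set.Ioc a b, cexp (-(y * s * I))‖ :=
          mul_le_mul_of_nonneg_right (h s) (norm_nonneg _)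
      _ = g s * (|s| * ‖∫ y in Set.Ioc a b, cexp (-(y * s * I))‖) := by ring
      _ ≤ g s * 2 := by gcongr; exact norm_mul_integral_cexp_le a b s
      _ = 2 * g s := by ring
  rw [integral_const_mul] at key
  calc _ ≤ 1 / (2 * Real.pi) * (2 * ∫ s, g s) := by gcongr
    _ = _ := by field_simp

theorem gaussianReal_real_Ici_le (x : ℝ) (v : ℝ≥0) {r : ℝ} (hr : 0 ≤ r) :
    (gaussianReal x v).real (Set.Ici (x + r)) ≤ Real.exp (-r ^ 2 / (2 * v)) := by
  have hmap := gaussianReal_map_sub_const (μ := x) (v := v) x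
  rw [sub_self] at hmap
  have h : HasSubgaussianMGF (fun y => y - x) v (gaussianReal x v) := by
    constructor
    · intro t
      simp_rw [mul_sub, Real.exp_sub]
      exact (integrable_exp_mul_gaussianReal t).div_const _
    · intro t
      rw [mgf_gaussianReal hmap]; simp
  refine le_trans (le_of_eq ?_) (h.measure_ge_le hr)
  congr 1; ext y
  change x + r ≤ y ↔ r ≤ y - x
  constructor <;> intro <;> linarith

theorem gaussianReal_real_Iic_le (x : ℝ) (v : ℝ≥0) {r : ℝ} (hr : 0 ≤ r) :
    (gaussianReal x v).real (Set.Iic (x - r)) ≤ Real.exp (-r ^ 2 / (2 * v)) := by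
  have h := gaussianReal_real_Ici_le (-x) v hr
  rw [← gaussianReal_map_neg, map_measureReal_apply measurable_neg measurableSet_Ici] at h
  convert h using 2
  ext y
  change y ≤ x - r ↔ -x + r ≤ -y
  constructor <;> intro <;> linarith

theorem measurable_gaussianReal_real (v : ℝ≥0) {s : Set ℝ} (hs : MeasurableSet s) :
    Measurable fun x => (gaussianReal x v).real s :=
  ((Measure.measurable_coe hs).comp (measurable_gaussianReal.comp
    (measurable_id.prodMk measurable_const))).ennreal_toReal

/-- Gaussian smoothing inequality: the upper tails of two probability measures on the line are
comparable, up to a shift, when their characteristic functions are close. -/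
theorem measureReal_Ici_le_of_charFun (μ ν : Measure ℝ) [IsProbabilityMeasure μ]
    [IsProbabilityMeasure ν] (v : ℝ≥0) (hv : v ≠ 0) {g : ℝ → ℝ} (hg : Integrable g)
    (h : ∀ s, ‖charFun μ s - charFun ν s‖ * Real.exp (-(v / 2) * s ^ 2) ≤ |s| * g s)
    (y : ℝ) {r : ℝ} (hr : 0 ≤ r) :
    μ.real (Set.Ici y) ≤ ν.real (Set.Ici (y - 2 * r)) + 3 * Real.exp (-r ^ 2 / (2 * v))
      + 1 / Real.pi * ∫ s, g s := by
  set τ := Real.exp (-r ^ 2 / (2 * v)) with hτ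
  have hτ0 : 0 < τ := Real.exp_pos _
  have hint : ∀ (ρ : Measure ℝ) [IsProbabilityMeasure ρ] (s : Set ℝ), MeasurableSet s →
      Integrable (fun x => (gaussianReal x v).real s) ρ := fun ρ _ s hs =>
    Integrable.of_bound (measurable_gaussianReal_real v hs).aestronglyMeasurable 1
      (.of_forall fun x => by
        rw [Real.norm_eq_abs, abs_of_nonneg measureReal_nonneg]; exact measureReal_le_one)
  -- Inversion is available for bounded intervals only, so the half-line is exhausted by `[y, B)`.
  have hlim : Filter.Tendsto (fun B => μ.real (Set.Ico y B)) Filter.atTop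
      (nhds (μ.real (Set.Ici y))) :=
    (ENNReal.tendsto_toReal (measure_ne_top _ _)).comp (tendsto_measure_Ico_atTop μ y)
  refine le_of_tendsto' hlim fun B => ?_
  -- A point of `[y, B)` stays in the widened interval unless the noise exceeds `r` in one of two
  -- directions (cost `2τ`); a noisy point in it comes from above `y - 2r` unless the noise exceeds
  -- `r` upwards (cost `τ`).
  set s := Set.Ioc (y - r) (B + r) with hs
  have h1 : μ.real (Set.Ico y B) ≤ ∫ x, (gaussianReal x v).real s ∂μ + 2 * τ := by
    calc μ.real (Set.Ico y B) = ∫ x, (Set.Ico y B).indicator 1 x ∂μ :=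
          (integral_indicator_one measurableSet_Ico).symm
      _ ≤ ∫ x, ((gaussianReal x v).real s + 2 * τ) ∂μ := by
          refine integral_mono ((integrable_const 1).indicator measurableSet_Ico)
            ((hint μ s measurableSet_Ioc).add (integrable_const _)) fun x => ?_
          by_cases hx : x ∈ Set.Ico y B
          · have hcov : Set.univ ⊆ s ∪ (Set.Iic (x - r) ∪ Set.Ici (x + r)) := by
              intro z _
              simp only [hs, Set.mem_union, Set.mem_Ioc, Set.mem_Iic, Set.mem_Ici]
              by_contra! hz
              linarith [hx.1, hx.2, hz.1 (by linarith [hx.1, hz.2.1])]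
            have := (measureReal_mono (μ := gaussianReal x v) hcov).trans
              ((measureReal_union_le _ _).trans (add_le_add_right (measureReal_union_le _ _) _))
            rw [probReal_univ] at this
            simp only [Set.indicator_of_mem hx, Pi.one_apply]
            linarith [gaussianReal_real_Ici_le x v hr, gaussianReal_real_Iic_le x v hr]
          · simp only [Set.indicator_of_notMem hx]
            positivity
      _ = _ := by rw [integral_add (hint μ s measurableSet_Ioc) (integrable_const _)]; simp
  have h2 : ∫ x, (gaussianReal x v).real s ∂ν ≤ ν.real (Set.Ici (y - 2 * r)) + τ := by
    calc _ ≤ ∫ x, ((Set.Ici (y - 2 * r)).indicator 1 x + τ) ∂ν := by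
          refine integral_mono (hint ν s measurableSet_Ioc)
            (((integrable_const 1).indicator measurableSet_Ici).add (integrable_const _)) fun x => ?_
          by_cases hx : x ∈ Set.Ici (y - 2 * r)
          · simp only [Set.indicator_of_mem hx, Pi.one_apply]
            linarith [measureReal_le_one (μ := gaussianReal x v) (s := s)]
          · simp only [Set.indicator_of_notMem hx, zero_add]
            refine (measureReal_mono ?_).trans (gaussianReal_real_Ici_le x v hr)
            intro z hz
            rw [Set.mem_Ici, not_le] at hx
            rw [Set.mem_Ici]; linarith [hz.1]
      _ = _ := by
          rw [integral_add ((integrable_const 1).indicator measurableSet_Ici) (integrable_const _),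
            integral_indicator_one measurableSet_Ici]
          simp
  linarith [abs_le.mp (abs_integral_gaussianReal_Ioc_sub_le μ ν v hv (y - r) (B + r) hg h)]

end

/-! ### Characteristic functions of i.i.d. sums and the normal approximation. -/

section

open ProbabilityTheory Complex NNReal

/-- Telescoping. Keeping `m ^ n` preserves the Gaussian decay of the powers. -/
theorem norm_pow_sub_pow_le (a b : ℂ) {m : ℝ} (ha : ‖a‖ ≤ m) (hb : ‖b‖ ≤ m) (n : ℕ) :
    ‖a ^ (n + 1) - b ^ (n + 1)‖ ≤ (n + 1) * ‖a - b‖ * m ^ n := by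
  have hm : 0 ≤ m := (norm_nonneg a).trans ha
  induction n with
  | zero => simp
  | succ n ih =>
    have h : a ^ (n + 1 + 1) - b ^ (n + 1 + 1) = a * (a ^ (n + 1) - b ^ (n + 1)) +
        (a - b) * b ^ (n + 1) := by ring
    rw [h]
    calc _ ≤ ‖a‖ * ‖a ^ (n + 1) - b ^ (n + 1)‖ + ‖a - b‖ * ‖b‖ ^ (n + 1) := by
          refine (norm_add_le _ _).trans_eq ?_
          rw [norm_mul, norm_mul, norm_pow]
      _ ≤ m * ((n + 1) * ‖a - b‖ * m ^ n) + ‖a - b‖ * m ^ (n + 1) := by gcongr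
      _ = _ := by push_cast; ring

theorem norm_charFun_sub_quadratic_le (μ : Measure ℝ) [IsProbabilityMeasure μ] {B : ℝ}
    (hB : ∀ᵐ x ∂μ, |x| ≤ B) (h0 : ∫ x, x ∂μ = 0) {V : ℝ} (hV : ∫ x, x ^ 2 ∂μ = V) {s : ℝ}
    (hs : |s| * B ≤ 1) :
    ‖charFun μ s - (1 - V * s ^ 2 / 2 : ℝ)‖ ≤ B ^ 3 * |s| ^ 3 := by
  have hi1 : Integrable (fun x : ℝ => x) μ := Integrable.of_bound (by fun_prop) B hB
  have hi2 : Integrable (fun x : ℝ => x ^ 2) μ := Integrable.of_bound (by fun_prop) (B ^ 2) (by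
    filter_upwards [hB] with x hx
    rw [norm_pow]; exact pow_le_pow_left₀ (norm_nonneg _) hx 2)
  have hi3 : Integrable (fun x : ℝ => cexp (s * x * I)) μ :=
    Integrable.of_bound (by fun_prop) 1 (.of_forall fun x => by
      rw [show (s * x * I : ℂ) = (s * x : ℝ) * I by push_cast; ring, norm_exp_ofReal_mul_I])
  have hi4 : Integrable (fun x : ℝ => (1 + s * x * I - s ^ 2 * ((x ^ 2 : ℝ) : ℂ) / 2 : ℂ)) μ :=
    ((integrable_const _).add ((hi1.ofReal.const_mul _).mul_const _)).sub
      ((hi2.ofReal.const_mul _).div_const _)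
  have h1 : (((1 - V * s ^ 2 / 2 : ℝ)) : ℂ) =
      ∫ x : ℝ, (1 + s * x * I - s ^ 2 * ((x ^ 2 : ℝ) : ℂ) / 2 : ℂ) ∂μ := by
    rw [integral_sub, integral_add, integral_mul_const, integral_const_mul, integral_div,
      integral_const_mul, integral_complex_ofReal, integral_complex_ofReal, h0, hV]
    · simp; ring
    · exact integrable_const _
    · exact (hi1.ofReal.const_mul _).mul_const _
    · exact (integrable_const _).add ((hi1.ofReal.const_mul _).mul_const _)
    · exact (hi2.ofReal.const_mul _).div_const _
  rw [h1, charFun_apply_real, ← integral_sub hi3 hi4]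
  have := norm_integral_le_of_norm_le (μ := μ) (integrable_const (B ^ 3 * |s| ^ 3))
    (f := fun x : ℝ => cexp (s * x * I) - (1 + s * x * I - s ^ 2 * ((x ^ 2 : ℝ) : ℂ) / 2)) (by
      filter_upwards [hB] with x hx
      have hsx : |s| * |x| ≤ |s| * B := by gcongr
      have hn : ‖(s * x * I : ℂ)‖ = |s| * |x| := by simp
      have h := Complex.exp_bound (x := s * x * I) (by rw [hn]; linarith) (n := 3) (by norm_num)
      have he : ∑ m ∈ Finset.range 3, (s * x * I : ℂ) ^ m / m.factorial =
          1 + s * x * I - s ^ 2 * ((x ^ 2 : ℝ) : ℂ) / 2 := by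
        simp only [Finset.sum_range_succ, Finset.sum_range_zero, mul_pow, I_sq, Nat.factorial]
        push_cast; ring
      rw [he, hn] at h
      refine h.trans ?_
      have h3 : (|s| * |x|) ^ 3 ≤ (|s| * B) ^ 3 := by gcongr
      have h4 : 0 ≤ (|s| * |x|) ^ 3 := by positivity
      norm_num [Nat.factorial]
      nlinarith)
  simpa using this

/-- Third-order comparison of the characteristic function of a bounded centred distribution with
the Gaussian one, near the origin. -/
theorem exists_charFun_near_zero (μ : Measure ℝ) [IsProbabilityMeasure μ] {B : ℝ}
    (hB : ∀ᵐ x ∂μ, |x| ≤ B) (h0 : ∫ x, x ∂μ = 0) {V : ℝ} (hV : ∫ x, x ^ 2 ∂μ = V) (hVpos : 0 < V) :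
    ∃ c > 0, ∃ D > 0, ∀ s : ℝ, |s| ≤ c →
      ‖charFun μ s - (Real.exp (-(V / 2) * s ^ 2) : ℝ)‖ ≤ D * |s| ^ 3 ∧
      ‖charFun μ s‖ ≤ Real.exp (-(V / 4) * s ^ 2) := by
  have hB0 : 0 ≤ B := by
    obtain ⟨x, hx⟩ := hB.exists
    exact (abs_nonneg x).trans hx
  -- The bounds `1` and `1/V` give `V s² ≤ 1`, and `1` also turns `|s|⁴` into `|s|³`; `1/(B+1)`
  -- gives `|s| B ≤ 1`; the last makes the cubic remainder at most `V s²/4`. `B + 1` is used because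
  -- `B` may vanish.
  set c := min 1 (min (1 / (B + 1)) (min (1 / V) (V / (4 * (B + 1) ^ 3)))) with hc
  have hc1 : c ≤ 1 := min_le_left _ _
  have hc2 : c ≤ 1 / (B + 1) := (min_le_right _ _).trans (min_le_left _ _)
  have hc3 : c ≤ 1 / V := (min_le_right _ _).trans ((min_le_right _ _).trans (min_le_left _ _))
  have hc4 : c ≤ V / (4 * (B + 1) ^ 3) :=
    (min_le_right _ _).trans ((min_le_right _ _).trans (min_le_right _ _))
  refine ⟨c, by positivity, B ^ 3 + V ^ 2, by positivity, fun s hs => ?_⟩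
  have hs0 := abs_nonneg s
  rw [le_div_iff₀ (by positivity)] at hc2 hc3 hc4
  have hsB : |s| * B ≤ 1 := by nlinarith
  have hq := norm_charFun_sub_quadratic_le μ hB h0 hV hsB
  have hsq : s ^ 2 = |s| ^ 2 := (sq_abs s).symm
  have hsV : V * s ^ 2 ≤ 1 := by
    rw [hsq]
    nlinarith [mul_le_mul_of_nonneg_left hs hVpos.le,
      mul_le_mul_of_nonneg_left (hs.trans hc1) (mul_nonneg hVpos.le hs0)]
  have hVs : 0 ≤ V * s ^ 2 := by positivity
  constructor
  · have he := Real.abs_exp_sub_one_sub_id_le (x := -(V / 2) * s ^ 2) (by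
      rw [abs_le]; constructor <;> nlinarith)
    have h2 : ‖(((1 - V * s ^ 2 / 2 : ℝ)) : ℂ) - (Real.exp (-(V / 2) * s ^ 2) : ℝ)‖ ≤
        V ^ 2 * |s| ^ 3 := by
      rw [← Complex.ofReal_sub, Complex.norm_real, Real.norm_eq_abs, abs_sub_comm]
      rw [show Real.exp (-(V / 2) * s ^ 2) - (1 - V * s ^ 2 / 2) =
        Real.exp (-(V / 2) * s ^ 2) - 1 - -(V / 2) * s ^ 2 by ring]
      refine he.trans ?_
      rw [hsq, show (-(V / 2) * |s| ^ 2) ^ 2 = V ^ 2 * |s| ^ 3 * (|s| / 4) by ring]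
      exact mul_le_of_le_one_right (by positivity) (by linarith)
    calc _ ≤ _ := norm_sub_le_norm_sub_add_norm_sub _ (((1 - V * s ^ 2 / 2 : ℝ)) : ℂ) _
      _ ≤ B ^ 3 * |s| ^ 3 + V ^ 2 * |s| ^ 3 := add_le_add hq h2
      _ = _ := by ring
  · have h1 : ‖charFun μ s‖ ≤ |1 - V * s ^ 2 / 2| + B ^ 3 * |s| ^ 3 := by
      have := norm_le_norm_add_norm_sub' (charFun μ s) ((1 - V * s ^ 2 / 2 : ℝ) : ℂ)
      rw [Complex.norm_real, Real.norm_eq_abs] at this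
      linarith
    rw [abs_of_nonneg (by linarith)] at h1
    have h2 : B ^ 3 * |s| ≤ V / 4 := by
      have : B ^ 3 ≤ (B + 1) ^ 3 := by gcongr; linarith
      have : B ^ 3 * |s| ≤ (B + 1) ^ 3 * c := by gcongr
      linarith
    have h3 : B ^ 3 * |s| ^ 3 ≤ V / 4 * s ^ 2 := by
      rw [show B ^ 3 * |s| ^ 3 = (B ^ 3 * |s|) * s ^ 2 by rw [hsq]; ring]
      gcongr
    have h4 := Real.add_one_le_exp (-(V / 4) * s ^ 2)
    linarith

theorem integral_gaussian_const_mul (a b : ℝ) : ∫ s : ℝ, a * Real.exp (-b * s ^ 2) =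
    a * √(Real.pi / b) := by
  rw [integral_const_mul, integral_gaussian]

/-- The integrand controlling the smoothed distance of the `n`-fold sum to the Gaussian. -/
theorem norm_charFun_pow_sub_le (μ ρ : Measure ℝ) [IsProbabilityMeasure μ] [IsProbabilityMeasure ρ]
    {V : ℝ≥0} (hV : V ≠ 0) {c D : ℝ} (hc : 0 < c) (hD : 0 < D) (h : ∀ s : ℝ, |s| ≤ c →
      ‖charFun μ s - (Real.exp (-(V / 2) * s ^ 2) : ℝ)‖ ≤ D * |s| ^ 3 ∧
      ‖charFun μ s‖ ≤ Real.exp (-(V / 4) * s ^ 2)) {n : ℕ} (hn : 2 ≤ n)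
    (hρ : ∀ s, charFun ρ s = charFun μ s ^ n) (v : ℝ≥0) (s : ℝ) :
    ‖charFun ρ s - charFun (gaussianReal 0 (n * V)) s‖ * Real.exp (-(v / 2) * s ^ 2) ≤
      |s| * (16 * D / V * Real.exp (-(n * V / 16) * s ^ 2) +
        2 / c * Real.exp (-(v * c ^ 2 / 4)) * Real.exp (-(v / 4) * s ^ 2)) := by
  have hV' : (0 : ℝ) < V := by positivity
  have hs0 := abs_nonneg s
  have hsq : s ^ 2 = |s| ^ 2 := (sq_abs s).symm
  rcases le_or_gt |s| c with hs | hs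
  · obtain ⟨h1, h2⟩ := h s hs
    obtain ⟨k, rfl⟩ : ∃ k, n = k + 1 := ⟨n - 1, by omega⟩
    have hk : (1 : ℝ) ≤ k := by exact_mod_cast (by omega : 1 ≤ k)
    have hg : charFun (gaussianReal 0 ((k + 1 : ℕ) * V)) s =
        ((Real.exp (-(V / 2) * s ^ 2) : ℝ) : ℂ) ^ (k + 1) := by
      rw [charFun_gaussianReal, Complex.ofReal_exp, ← Complex.exp_nat_mul]
      congr 1; push_cast; ring
    have hb : ‖((Real.exp (-(V / 2) * s ^ 2) : ℝ) : ℂ)‖ ≤ Real.exp (-(V / 4) * s ^ 2) := by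
      rw [Complex.norm_real, Real.norm_eq_abs, abs_of_pos (Real.exp_pos _), Real.exp_le_exp]
      nlinarith [sq_nonneg s]
    have hp := norm_pow_sub_pow_le _ _ h2 hb k
    rw [← hρ, ← hg, ← Real.exp_nat_mul] at hp
    -- Part of the Gaussian decay is traded, through `x ≤ exp x`, for a factor `1/(k+1)` that
    -- cancels the telescoping factor. The exponents fit because `k/4 - (k+1)/16 ≥ (k+1)/16` once `k
    -- ≥ 1`.
    have hx : s ^ 2 * Real.exp (k * (-(V / 4) * s ^ 2)) ≤
        16 / ((k + 1) * V) * Real.exp (-((k + 1) * V / 16) * s ^ 2) := by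
      have h3 := Real.add_one_le_exp ((k + 1) * V / 16 * s ^ 2)
      have h4 : s ^ 2 ≤ 16 / ((k + 1) * V) * Real.exp ((k + 1) * V / 16 * s ^ 2) := by
        rw [div_mul_eq_mul_div, le_div_iff₀ (by positivity)]; nlinarith
      calc _ ≤ (16 / ((k + 1) * V) * Real.exp ((k + 1) * V / 16 * s ^ 2)) *
            Real.exp (k * (-(V / 4) * s ^ 2)) := by gcongr
        _ = 16 / ((k + 1) * V) * Real.exp ((k + 1) * V / 16 * s ^ 2 + k * (-(V / 4) * s ^ 2)) := by
          rw [Real.exp_add]; ring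
        _ ≤ _ := by
          gcongr
          have : 0 ≤ (k - 1 : ℝ) * (V * s ^ 2) := mul_nonneg (by linarith) (by positivity)
          nlinarith
    calc _ ≤ ((k + 1) * ‖charFun μ s - (Real.exp (-(V / 2) * s ^ 2) : ℝ)‖ *
            Real.exp (k * (-(V / 4) * s ^ 2))) * 1 := by
          gcongr
          rw [Real.exp_le_one_iff]
          have : 0 ≤ (v : ℝ) / 2 * s ^ 2 := by positivity
          linarith
      _ ≤ ((k + 1) * (D * |s| ^ 3) * Real.exp (k * (-(V / 4) * s ^ 2))) * 1 := by gcongr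
      _ = (k + 1) * D * |s| * (s ^ 2 * Real.exp (k * (-(V / 4) * s ^ 2))) := by rw [hsq]; ring
      _ ≤ (k + 1) * D * |s| * (16 / ((k + 1) * V) * Real.exp (-((k + 1) * V / 16) * s ^ 2)) := by
          gcongr
      _ = |s| * (16 * D / V * Real.exp (-((k + 1 : ℕ) * V / 16) * s ^ 2)) := by
          push_cast; field_simp
      _ ≤ _ := by
          gcongr
          exact le_add_of_nonneg_right (by positivity)
  · have h1 : ‖charFun ρ s - charFun (gaussianReal 0 (n * V)) s‖ ≤ 2 := by
      have := norm_sub_le (charFun ρ s) (charFun (gaussianReal 0 (n * V)) s)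
      linarith [norm_charFun_le_one (μ := ρ) s, norm_charFun_le_one (μ := gaussianReal 0 (n * V)) s]
    -- Half of the damping exponent yields a small constant on `|s| > c`; the other half remains for
    -- integrability.
    have h2 : Real.exp (-(v / 2) * s ^ 2) ≤
        Real.exp (-(v * c ^ 2 / 4)) * Real.exp (-(v / 4) * s ^ 2) := by
      rw [← Real.exp_add, Real.exp_le_exp]
      have : (v : ℝ) * c ^ 2 ≤ v * s ^ 2 := by rw [hsq]; gcongr
      linarith
    calc _ ≤ 2 * (Real.exp (-(v * c ^ 2 / 4)) * Real.exp (-(v / 4) * s ^ 2)) := by gcongr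
      _ ≤ 2 * (Real.exp (-(v * c ^ 2 / 4)) * Real.exp (-(v / 4) * s ^ 2)) * (|s| / c) := by
          refine le_mul_of_one_le_right (by positivity) ?_
          rw [one_le_div hc]; exact hs.le
      _ = |s| * (2 / c * Real.exp (-(v * c ^ 2 / 4)) * Real.exp (-(v / 4) * s ^ 2)) := by
          field_simp
      _ ≤ _ := by
          gcongr
          exact le_add_of_nonneg_left (by positivity)

/-- A normal approximation for sums of bounded i.i.d. random variables, up to an error of order
`n ^ (-1/2)` in probability and a shift of order `log n`. -/
theorem exists_gaussian_approx (μ : Measure ℝ) [IsProbabilityMeasure μ] {B : ℝ}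
    (hB : ∀ᵐ x ∂μ, |x| ≤ B) (h0 : ∫ x, x ∂μ = 0) {V : ℝ≥0} (hV : ∫ x, x ^ 2 ∂μ = V) (hV0 : V ≠ 0) :
    ∃ R > 0, ∃ C > 0, ∀ n : ℕ, 3 ≤ n → ∀ (ρ : Measure ℝ) [IsProbabilityMeasure ρ],
      (∀ s, charFun ρ s = charFun μ s ^ n) → ∀ y : ℝ,
      ρ.real (Set.Ici y) ≤
        (gaussianReal 0 (n * V)).real (Set.Ici (y - R * Real.log n)) + C / √n ∧
      (gaussianReal 0 (n * V)).real (Set.Ici (y + R * Real.log n)) ≤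
        ρ.real (Set.Ici y) + C / √n := by
  have hV' : (0 : ℝ) < V := by positivity
  obtain ⟨c, hc, D, hD, h⟩ := exists_charFun_near_zero μ hB h0 hV hV'
  refine ⟨6 / c, by positivity, 3 + 1 / Real.pi * (16 * D / V * √(16 * Real.pi / V) +
    2 / c * √(Real.pi * c ^ 2)), by positivity, fun n hn ρ _ hρ y => ?_⟩
  have hn' : (3 : ℝ) ≤ n := by exact_mod_cast hn
  have hn0 : (0 : ℝ) < n := by linarith
  have hlog : 1 ≤ Real.log n := by
    rw [Real.le_log_iff_exp_le hn0]
    linarith [Real.exp_one_lt_d9]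
  -- This variance makes `exp (-v c²/4)` equal to `1/n`.
  obtain ⟨v, hv⟩ : ∃ v : ℝ≥0, (v : ℝ) = 4 / c ^ 2 * Real.log n :=
    ⟨⟨4 / c ^ 2 * Real.log n, by positivity⟩, rfl⟩
  have hv0 : v ≠ 0 := by
    rw [← NNReal.coe_ne_zero, hv]; positivity
  have hvpos : (0 : ℝ) < v := by positivity
  set g : ℝ → ℝ := fun s => 16 * D / V * Real.exp (-(n * V / 16) * s ^ 2) +
        2 / c * Real.exp (-(v * c ^ 2 / 4)) * Real.exp (-(v / 4) * s ^ 2) with hgdef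
  have hg1 : Integrable fun s : ℝ => 16 * D / V * Real.exp (-(n * V / 16) * s ^ 2) :=
    (integrable_exp_neg_mul_sq (by positivity)).const_mul _
  have hg2 : Integrable fun s : ℝ =>
      2 / c * Real.exp (-(v * c ^ 2 / 4)) * Real.exp (-(v / 4) * s ^ 2) :=
    (integrable_exp_neg_mul_sq (by positivity)).const_mul _
  have hle : ∀ s, ‖charFun ρ s - charFun (gaussianReal 0 (n * V)) s‖ *
      Real.exp (-(v / 2) * s ^ 2) ≤ |s| * g s :=
    norm_charFun_pow_sub_le μ ρ hV0 hc hD h (by omega) hρ v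
  have hexp : Real.exp (-(v * c ^ 2 / 4)) = 1 / n := by
    rw [hv, show 4 / c ^ 2 * Real.log n * c ^ 2 / 4 = Real.log n by field_simp, Real.exp_neg,
      Real.exp_log hn0, one_div]
  have hsn : 1 ≤ √(n : ℝ) := Real.one_le_sqrt.mpr (by linarith)
  have hinv : 1 / (n : ℝ) ≤ 1 / √n := by
    rw [one_div_le_one_div hn0 (by positivity)]
    nlinarith [Real.sq_sqrt hn0.le]
  -- The low-frequency Gaussian has width of order `1/√n`, which is the source of the rate; the
  -- other term carries the factor `1/n`.
  have hI : ∫ s, g s ≤ (16 * D / V * √(16 * Real.pi / V) + 2 / c * √(Real.pi * c ^ 2)) / √n := by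
    rw [hgdef, integral_add hg1 hg2, integral_gaussian_const_mul, integral_gaussian_const_mul, hexp,
      add_div]
    refine add_le_add (le_of_eq ?_) ?_
    · rw [show Real.pi / (n * V / 16) = 16 * Real.pi / V / n by field_simp,
        Real.sqrt_div' _ hn0.le]
      ring
    · have : √(Real.pi / (v / 4)) ≤ √(Real.pi * c ^ 2) := by
        apply Real.sqrt_le_sqrt
        rw [hv, div_le_iff₀ (by positivity),
          show Real.pi * c ^ 2 * (4 / c ^ 2 * Real.log n / 4) = Real.pi * Real.log n by field_simp]
        nlinarith [Real.pi_pos]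
      calc _ ≤ 2 / c * (1 / √n) * √(Real.pi * c ^ 2) := by gcongr
        _ = _ := by ring
  -- Then `r²/(2v) = (9/8) log n`, so the noise exceeds `r` with probability at most `1/n`; the
  -- total shift `2r` explains `R = 6/c`.
  set r := 3 / c * Real.log n with hr
  have hr0 : 0 ≤ r := by positivity
  have htail : Real.exp (-r ^ 2 / (2 * v)) ≤ 1 / √n := by
    refine le_trans ?_ hinv
    rw [← hexp, Real.exp_le_exp, hv, hr,
      show -(3 / c * Real.log n) ^ 2 / (2 * (4 / c ^ 2 * Real.log n)) = -(9 / 8 * Real.log n) by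
        field_simp; ring,
      show 4 / c ^ 2 * Real.log n * c ^ 2 / 4 = Real.log n by field_simp]
    linarith
  have hsum : 3 * Real.exp (-r ^ 2 / (2 * v)) + 1 / Real.pi * ∫ s, g s ≤
      (3 + 1 / Real.pi * (16 * D / V * √(16 * Real.pi / V) + 2 / c * √(Real.pi * c ^ 2))) / √n := by
    calc _ ≤ 3 * (1 / √n) + 1 / Real.pi *
          ((16 * D / V * √(16 * Real.pi / V) + 2 / c * √(Real.pi * c ^ 2)) / √n) := by gcongr
      _ = _ := by ring
  have hR : 6 / c * Real.log n = 2 * r := by rw [hr]; ring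
  rw [hR]
  constructor
  · have := measureReal_Ici_le_of_charFun ρ (gaussianReal 0 (n * V)) v hv0 (hg1.add hg2) hle y hr0
    linarith!
  · have := measureReal_Ici_le_of_charFun (gaussianReal 0 (n * V)) ρ v hv0 (hg1.add hg2)
      (fun s => by rw [norm_sub_rev]; exact hle s) (y + 2 * r) hr0
    rw [add_sub_cancel_right] at this
    linarith!

end

/-! ### Locating the quantile and the second-order expansion. -/

section

open ProbabilityTheory NNReal Filter

theorem gaussianReal_real_Ici_eq_gaussianQ {w : ℝ≥0} (hw : w ≠ 0) (y : ℝ) :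
    (gaussianReal 0 w).real (Set.Ici y) = gaussianQ (y / √w) := by
  have hw' : (0 : ℝ) < √w := Real.sqrt_pos.mpr (by positivity)
  have h := gaussianReal_map_const_mul (μ := 0) (v := 1) (√(w : ℝ))
  have hv : NNReal.mk (√(w : ℝ) ^ 2) (sq_nonneg _) * 1 = w := by
    ext; simp
  rw [hv, mul_zero] at h
  have := nullSingletonClass_gaussianReal (μ := 0) (v := 1) one_ne_zero
  rw [← h, map_measureReal_apply (by fun_prop) measurableSet_Ici, gaussianQ_eq,
    measureReal_def, measureReal_def, measure_congr (Ioi_ae_eq_Ici (a := y / √(w : ℝ)))]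
  congr 2
  ext z
  change y ≤ √(w : ℝ) * z ↔ y / √(w : ℝ) ≤ z
  rw [div_le_iff₀' hw']

/-- Near any point, the Gaussian tail decreases at least linearly. -/
theorem exists_gaussianQ_linear_decrease (q : ℝ) :
    ∃ k > 0, ∀ h : ℝ, 0 ≤ h → h ≤ 1 →
      gaussianQ (q + h) ≤ gaussianQ q - k * h ∧ gaussianQ q + k * h ≤ gaussianQ (q - h) := by
  -- A lower bound for the Gaussian density on `[q - 1, q + 1]`.
  set d := 1 / √(2 * Real.pi) * Real.exp (-(|q| + 1) ^ 2 / 2) with hd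
  have key : ∀ a b : ℝ, a ≤ b → q - 1 ≤ a → b ≤ q + 1 → d * (b - a) ≤ gaussianQ a - gaussianQ b := by
    intro a b hab ha hb
    rw [gaussianQ_sub]
    have := intervalIntegral.integral_mono_on (μ := volume) (f := fun _ => d) hab
      intervalIntegrable_const integrable_gaussianQ_density.intervalIntegrable (fun u hu => by
        have hu2 : u ^ 2 ≤ (|q| + 1) ^ 2 := by
          rw [sq_le_sq, abs_of_nonneg (by positivity : 0 ≤ |q| + 1), abs_le]
          constructor <;> linarith [hu.1, hu.2, neg_abs_le q, le_abs_self q]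
        rw [hd]; gcongr)
    rw [intervalIntegral.integral_const, smul_eq_mul] at this
    linarith
  refine ⟨d, by positivity, fun h h0 h1 => ⟨?_, ?_⟩⟩
  · linarith [key q (q + h) (by linarith) (by linarith) (by linarith)]
  · linarith [key (q - h) q (by linarith) (by linarith) (by linarith)]

theorem tendsto_log_div_sqrt_atTop :
    Tendsto (fun n : ℕ => Real.log n / √n) atTop (nhds 0) := by
  have h := (isLittleO_log_rpow_atTop (r := 1 / 2) (by norm_num)).tendsto_div_nhds_zero
  simpa [Real.sqrt_eq_rpow, Function.comp_def] using h.comp (tendsto_natCast_atTop_atTop (R := ℝ))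

variable {𝒳 : Type*} [Fintype 𝒳] [MeasurableSpace 𝒳] [DiscreteMeasurableSpace 𝒳]

theorem integral_entropyDensity (P : PMF 𝒳) : ∫ x, entropyDensity P x ∂P.toMeasure = entropy P := by
  rw [PMF.integral_eq_sum, entropy, ← Finset.sum_neg_distrib]
  exact Finset.sum_congr rfl fun x _ => by simp [entropyDensity]

/-- The law of the centred entropy density. -/
def centredLaw (P : PMF 𝒳) : Measure ℝ :=
  P.toMeasure.map fun x => entropyDensity P x - entropy P

instance (P : PMF 𝒳) : IsProbabilityMeasure (centredLaw P) :=
  Measure.isProbabilityMeasure_map (measurable_of_finite _).aemeasurable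

theorem integral_centredLaw (P : PMF 𝒳) {f : ℝ → ℝ} (hf : Continuous f) :
    ∫ x, f x ∂centredLaw P = ∫ x, f (entropyDensity P x - entropy P) ∂P.toMeasure :=
  integral_map (measurable_of_finite _).aemeasurable hf.aestronglyMeasurable

theorem integral_id_centredLaw (P : PMF 𝒳) : ∫ x, x ∂centredLaw P = 0 := by
  rw [integral_centredLaw P continuous_id', integral_sub (.of_finite) (.of_finite),
    integral_entropyDensity]
  simp

theorem integral_sq_centredLaw (P : PMF 𝒳) : ∫ x, x ^ 2 ∂centredLaw P = dispersion P := by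
  rw [integral_centredLaw P (by fun_prop), dispersion,
    variance_eq_integral (measurable_of_finite _).aemeasurable, integral_entropyDensity]

theorem exists_bound_centredLaw (P : PMF 𝒳) : ∃ B, ∀ᵐ x ∂centredLaw P, |x| ≤ B := by
  refine ⟨∑ x, |entropyDensity P x - entropy P|, ?_⟩
  rw [centredLaw, ae_map_iff (measurable_of_finite _).aemeasurable
    (measurableSet_le continuous_abs.measurable measurable_const)]
  exact .of_forall fun x => Finset.single_le_sum
    (f := fun x => |entropyDensity P x - entropy P|) (fun _ _ => abs_nonneg _) (Finset.mem_univ x)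

/-- The law of the centred information content of `n` source symbols. -/
def centredSumLaw (P : PMF 𝒳) (n : ℕ) : Measure ℝ :=
  (sourceLaw P n).map fun x => ∑ i, (entropyDensity P (x i) - entropy P)

instance (P : PMF 𝒳) (n : ℕ) : IsProbabilityMeasure (centredSumLaw P n) :=
  Measure.isProbabilityMeasure_map (measurable_of_finite _).aemeasurable

theorem charFun_centredSumLaw (P : PMF 𝒳) (n : ℕ) (s : ℝ) :
    charFun (centredSumLaw P n) s = charFun (centredLaw P) s ^ n := by
  rw [charFun_apply_real, charFun_apply_real, centredSumLaw, centredLaw,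
    integral_map (measurable_of_finite _).aemeasurable (by fun_prop),
    integral_map (measurable_of_finite _).aemeasurable (by fun_prop), sourceLaw]
  have h := integral_fintype_prod_eq_pow (ι := Fin n) (μ := P.toMeasure)
    fun x => Complex.exp (s * ((entropyDensity P x - entropy P : ℝ) : ℂ) * Complex.I)
  rw [Fintype.card_fin] at h
  rw [← h]
  congr 1; ext x
  rw [← Complex.exp_sum]
  congr 1
  push_cast
  rw [Finset.mul_sum, Finset.sum_mul]

theorem centredSumLaw_real_Ici (P : PMF 𝒳) (n : ℕ) (y : ℝ) :
    (centredSumLaw P n).real (Set.Ici y) =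
      (sourceLaw P n).real {x | n * entropy P + y ≤ ∑ i, entropyDensity P (x i)} := by
  rw [centredSumLaw, map_measureReal_apply (measurable_of_finite _) measurableSet_Ici]
  congr 1; ext x
  change y ≤ ∑ i, (entropyDensity P (x i) - entropy P) ↔
    n * entropy P + y ≤ ∑ i, entropyDensity P (x i)
  rw [Finset.sum_sub_distrib]
  simp only [Finset.sum_const, Finset.card_univ, Fintype.card_fin, nsmul_eq_mul]
  constructor <;> intro <;> linarith

theorem eventually_one_le_log : ∀ᶠ n : ℕ in atTop, 1 ≤ Real.log n :=
  (Real.tendsto_log_atTop.comp tendsto_natCast_atTop_atTop).eventually_ge_atTop 1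

theorem exists_tail_bounds_of_dispersion_pos (P : PMF 𝒳) (hV : 0 < dispersion P) {ε : ℝ}
    (hε : ε ∈ Set.Ioo (0 : ℝ) 1) :
    ∃ K > 0, ∀ᶠ n : ℕ in atTop,
      (centredSumLaw P n).real
        (Set.Ici (√(n * dispersion P) * gaussianQInv ε + K * Real.log n)) ≤ ε ∧
      ε + 1 / n < (centredSumLaw P n).real
        (Set.Ici (√(n * dispersion P) * gaussianQInv ε - K * Real.log n)) := by
  obtain ⟨V, hVd⟩ : ∃ V : ℝ≥0, (V : ℝ) = dispersion P := ⟨⟨_, hV.le⟩, rfl⟩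
  have hV0 : V ≠ 0 := by rw [← NNReal.coe_ne_zero, hVd]; exact hV.ne'
  obtain ⟨B, hB⟩ := exists_bound_centredLaw P
  obtain ⟨R, hR, C, hC, happrox⟩ := exists_gaussian_approx (centredLaw P) hB
    (integral_id_centredLaw P) (by rw [integral_sq_centredLaw, hVd]) hV0
  set q := gaussianQInv ε with hq
  have hQq : gaussianQ q = ε := gaussianQ_gaussianQInv hε
  obtain ⟨k, hk, hlin⟩ := exists_gaussianQ_linear_decrease q
  rw [← hVd]
  have hVpos : (0 : ℝ) < V := by positivity
  have hsV : 0 < √(V : ℝ) := Real.sqrt_pos.mpr hVpos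
  -- After division by `√(nV)` the shift `a log n` becomes `h` with `k h ≥ (C + 2)/√n`: `C` pays for
  -- the normal approximation and `2` for the slack `1/n < 2/√n`.
  set a := (C + 2) * √(V : ℝ) / k with ha
  have ha0 : 0 < a := by positivity
  have hsmall : ∀ᶠ n : ℕ in atTop, Real.log n / √n < k / (C + 2) :=
    tendsto_log_div_sqrt_atTop.eventually_lt_const (by positivity)
  refine ⟨R + a, by positivity, ?_⟩
  filter_upwards [hsmall, eventually_one_le_log, eventually_ge_atTop 3] with n hn1 hlog hn3
  have hn : (3 : ℝ) ≤ n := by exact_mod_cast hn3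
  have hn0 : (0 : ℝ) < n := by linarith
  have hsn : 1 < √(n : ℝ) := Real.lt_sqrt_of_sq_lt (by linarith)
  have hw0 : (n * V : ℝ≥0) ≠ 0 := mul_ne_zero (by exact_mod_cast hn0.ne') hV0
  have hw : √((n * V : ℝ≥0) : ℝ) = √n * √(V : ℝ) := by
    push_cast; exact Real.sqrt_mul hn0.le _
  have hw' : √((n : ℝ) * V) = √n * √(V : ℝ) := Real.sqrt_mul hn0.le _
  rw [hw']
  set h := (C + 2) / k * (Real.log n / √n) with hh
  have h0 : 0 ≤ h := by positivity
  have h1 : h ≤ 1 := by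
    rw [hh]
    calc _ ≤ (C + 2) / k * (k / (C + 2)) := by gcongr
      _ = 1 := by field_simp
  obtain ⟨hl1, hl2⟩ := hlin h h0 h1
  have hkh : (C + 2) / √n ≤ k * h := by
    rw [hh, show k * ((C + 2) / k * (Real.log n / √n)) = (C + 2) / √n * Real.log n by field_simp]
    exact le_mul_of_one_le_right (by positivity) hlog
  have hinv : 1 / (n : ℝ) < 2 / √n := by
    rw [div_lt_div_iff₀ hn0 (by positivity)]
    nlinarith [Real.sq_sqrt hn0.le]
  have hsplit : (C + 2) / √(n : ℝ) = C / √n + 2 / √n := add_div _ _ _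
  have h2n : 0 < 2 / √(n : ℝ) := by positivity
  have happ := happrox n hn3 (centredSumLaw P n) (charFun_centredSumLaw P n)
  constructor
  · have := (happ (√n * √(V : ℝ) * q + (R + a) * Real.log n)).1
    rw [gaussianReal_real_Ici_eq_gaussianQ hw0, hw,
      show (√n * √(V : ℝ) * q + (R + a) * Real.log n - R * Real.log n) / (√n * √(V : ℝ)) = q + h by
        rw [hh, ha]; field_simp; ring] at this
    linarith
  · have := (happ (√n * √(V : ℝ) * q - (R + a) * Real.log n)).2
    rw [gaussianReal_real_Ici_eq_gaussianQ hw0, hw,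
      show (√n * √(V : ℝ) * q - (R + a) * Real.log n + R * Real.log n) / (√n * √(V : ℝ)) = q - h by
        rw [hh, ha]; field_simp; ring] at this
    linarith

/-- A centred variable of zero variance vanishes almost surely; the law of the sum is then read off
its characteristic function. -/
theorem centredSumLaw_eq_dirac_of_dispersion_eq_zero (P : PMF 𝒳) (hV : dispersion P = 0) (n : ℕ) :
    centredSumLaw P n = Measure.dirac 0 := by
  have h0 : centredLaw P = Measure.dirac 0 := by
    have hi : Integrable (fun x : ℝ => x ^ 2) (centredLaw P) := by
      rw [centredLaw, integrable_map_measure (by fun_prop) (measurable_of_finite _).aemeasurable]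
      exact .of_finite
    have h := integral_sq_centredLaw P
    rw [hV, integral_eq_zero_iff_of_nonneg (fun x => sq_nonneg x) hi] at h
    have h' : (fun x : ℝ => x) =ᵐ[centredLaw P] fun _ => 0 := by
      filter_upwards [h] with x hx
      simpa using hx
    have := Measure.map_congr (mβ := Real.measurableSpace) h'
    simpa [Measure.map_id'] using this
  refine Measure.ext_of_charFun (funext fun s => ?_)
  rw [charFun_centredSumLaw, h0]
  simp [charFun_dirac]

/-- The upper `ε`-quantile is trapped in a window of width `O(log n)`. The slack `1/n` on the lower
side will absorb the penalty `exp (-δ)` of the converse. -/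
theorem exists_tail_bounds (P : PMF 𝒳) {ε : ℝ} (hε : ε ∈ Set.Ioo (0 : ℝ) 1) :
    ∃ K > 0, ∀ᶠ n : ℕ in atTop,
      (centredSumLaw P n).real
        (Set.Ici (√(n * dispersion P) * gaussianQInv ε + K * Real.log n)) ≤ ε ∧
      ε + 1 / n < (centredSumLaw P n).real
        (Set.Ici (√(n * dispersion P) * gaussianQInv ε - K * Real.log n)) := by
  have hV : 0 ≤ dispersion P := variance_nonneg _ _
  rcases hV.eq_or_lt with hV | hV
  -- For a point mass at 0 the tails at `log n` and `-log n` are 0 and 1, and `1/n < 1 - ε`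
  -- eventually.
  · refine ⟨1, one_pos, ?_⟩
    have hlim := (tendsto_one_div_atTop_nhds_zero_nat (𝕜 := ℝ)).eventually_lt_const
      (sub_pos.mpr hε.2)
    filter_upwards [eventually_one_le_log, hlim] with n hn hn2
    rw [centredSumLaw_eq_dirac_of_dispersion_eq_zero P hV.symm, ← hV]
    have h1 : ¬ Real.log n ≤ 0 := by linarith
    have h2 : 0 ≤ Real.log n := by linarith
    simp only [measureReal_def, Measure.dirac_apply]
    simp [h1, h2, hε.1.le]
    rw [← one_div]; linarith
  · exact exists_tail_bounds_of_dispersion_pos P hV hε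

/-- Achievability with `M = ⌈exp L⌉`. Rounding costs at most a factor 2 because `L ≥ 0`: a negative
threshold would make the tail probability 1. -/
theorem log_minCodewords_le (P : PMF 𝒳) (n : ℕ) {ε : ℝ} (hε : ε < 1) {L : ℝ}
    (h : (sourceLaw P n).real {x | L ≤ ∑ i, entropyDensity P (x i)} ≤ ε) :
    Real.log (minCodewords P n ε) ≤ L + Real.log 2 := by
  have hε0 : 0 ≤ ε := measureReal_nonneg.trans h
  have hL : 0 ≤ L := by
    by_contra! hL
    have : {x : Fin n → 𝒳 | L ≤ ∑ i, entropyDensity P (x i)} = Set.univ :=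
      Set.eq_univ_of_forall fun x =>
        hL.le.trans (Finset.sum_nonneg fun i _ => entropyDensity_nonneg P (x i))
    rw [this, probReal_univ] at h
    linarith
  have hM : 0 < ⌈Real.exp L⌉₊ := Nat.ceil_pos.mpr (Real.exp_pos _)
  obtain ⟨c, hc⟩ := exists_code_errorProb_le_tail P n ⌈Real.exp L⌉₊ hM
  have hlog : L ≤ Real.log (⌈Real.exp L⌉₊ : ℝ) := by
    rw [Real.le_log_iff_exp_le (by exact_mod_cast hM)]
    exact Nat.le_ceil _
  have hc' : c.errorProb P ≤ ε :=
    hc.trans ((measureReal_mono fun x hx => hlog.trans hx).trans h)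
  have hle : minCodewords P n ε ≤ ⌈Real.exp L⌉₊ := Nat.sInf_le ⟨c, hc'⟩
  have hpos : (0 : ℝ) < minCodewords P n ε := by exact_mod_cast minCodewords_pos P n hε0
  rw [Real.log_le_iff_le_exp hpos, Real.exp_add, Real.exp_log two_pos]
  have h1 : (minCodewords P n ε : ℝ) ≤ ⌈Real.exp L⌉₊ := by exact_mod_cast hle
  linarith [Nat.ceil_lt_add_one (Real.exp_pos L).le, Real.one_le_exp hL]

/-- The converse with `δ = log n`, whose penalty `exp (-δ)` is exactly `1/n`. -/
theorem le_log_minCodewords (P : PMF 𝒳) {n : ℕ} (hn : 0 < n) {ε : ℝ} (hε : 0 ≤ ε) {L : ℝ}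
    (h : ε + 1 / n < (sourceLaw P n).real {x | L ≤ ∑ i, entropyDensity P (x i)}) :
    L - Real.log n ≤ Real.log (minCodewords P n ε) := by
  by_contra! hlt
  obtain ⟨c, hc⟩ := minCodewords_spec P n hε
  have hconv := tail_sub_exp_le_errorProb P n _ (minCodewords_pos P n hε) (Real.log n) c
  rw [Real.exp_neg, Real.exp_log (by exact_mod_cast hn), ← one_div] at hconv
  have hmono : (sourceLaw P n).real {x | L ≤ ∑ i, entropyDensity P (x i)} ≤
      (sourceLaw P n).real {x | Real.log (minCodewords P n ε) + Real.log n ≤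
        ∑ i, entropyDensity P (x i)} :=
    measureReal_mono fun x (hx : L ≤ _) =>
      show Real.log (minCodewords P n ε) + Real.log n ≤ ∑ i, entropyDensity P (x i) by linarith
  linarith

theorem log_minCodewords_asymptotics (P : PMF 𝒳) {ε : ℝ} (hε : ε ∈ Set.Ioo (0 : ℝ) 1) :
    (fun n : ℕ => Real.log (minCodewords P n ε : ℝ)
      - ((n : ℝ) * entropy P + √((n : ℝ) * dispersion P) * gaussianQInv ε))
      =O[atTop] fun n : ℕ => Real.log (n : ℝ) := by
  obtain ⟨K, hK, hev⟩ := exists_tail_bounds P hε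
  -- `K` comes from the quantile window; the extra 1 covers `log 2` above and the converse's `log n`
  -- below.
  refine Asymptotics.IsBigO.of_bound (K + 1) ?_
  filter_upwards [hev, eventually_one_le_log, eventually_ge_atTop 1] with n hn hlog hn1
  rw [centredSumLaw_real_Ici, centredSumLaw_real_Ici] at hn
  have h1 := log_minCodewords_le P n hε.2 hn.1
  have h2 := le_log_minCodewords P hn1 hε.1.le hn.2
  rw [Real.norm_eq_abs, Real.norm_eq_abs, abs_of_nonneg (zero_le_one.trans hlog), abs_le]
  constructor <;> linarith [Real.log_two_lt_d9]

end

end LosslessSource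

end

theorem mainTheorem8 {𝒳 : Type*} [Fintype 𝒳] [MeasurableSpace 𝒳] [DiscreteMeasurableSpace 𝒳]
    (P : PMF 𝒳) :
    (∀ n M : ℕ, 0 < n → 0 < M →
      ∃ c : LosslessSource.Code 𝒳 n M,
        c.errorProb P ≤ (LosslessSource.sourceLaw P n).real
          {x | Real.log (M : ℝ) ≤ ∑ i, LosslessSource.entropyDensity P (x i)}) ∧
    (∀ n M : ℕ, 0 < n → 0 < M → ∀ γ : ℝ, 0 ≤ γ → ∀ c : LosslessSource.Code 𝒳 n M,
      (LosslessSource.sourceLaw P n).real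
          {x | Real.log (M : ℝ) + (n : ℝ) * γ ≤ ∑ i, LosslessSource.entropyDensity P (x i)}
        - Real.exp (-((n : ℝ) * γ)) ≤ c.errorProb P) ∧
    (∀ ε : ℝ, 0 < ε → ε < 1 →
      (fun n : ℕ => Real.log (LosslessSource.minCodewords P n ε : ℝ)
          - ((n : ℝ) * LosslessSource.entropy P
            + Real.sqrt ((n : ℝ) * LosslessSource.dispersion P)
              * LosslessSource.gaussianQInv ε))
        =O[Filter.atTop] fun n : ℕ => Real.log (n : ℝ)) :=
  ⟨fun n M _ hM => LosslessSource.exists_code_errorProb_le_tail P n M hM,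
    fun n M _ hM _ _ c => LosslessSource.tail_sub_exp_le_errorProb P n M hM _ c,
    fun _ h0 h1 => LosslessSource.log_minCodewords_asymptotics P ⟨h0, h1⟩⟩
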